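/- Let $m\ge 0$, let $\mathbb R^m$ carry its standard inner product, let $K\subset\mathbb R^m$ be a closed convex cone (nonempty, with $K+K\subset K$ and $tK\subset K$ for all $t\ge 0$), and let $K^*=\{y:\langle x,y\rangle\ge 0\ \forall x\in K\}$ be its dual. For a nonempty closed convex set $D$ let $P_D$ be the metric projection onto $D$ (nearest point map). Put $$x\sqcap y=P_{x-K}\,y,\quad x\sqcup y=P_{x+K}\,y,\quad x\sqcap_* y=P_{x-K^*}\,y,\quad x\sqcup_* y=P_{x+K^*}\,y .$$ A set $M\subset\mathbb R^m$ is called $K$-invariant if $x,y\in M$ implies $x\sqcap y,\ x\sqcup y,\ x\sqcap_* y,\ x\sqcup_* y\in M$. For a closed convex cone $L$, the projection $P_D$ is called $L$-isotone, and $D$ an $L$-isotone projection set, if $y-x\in L$ implies $P_Dy-P_Dx\in L$. For $u\ne 0$ and $a\in\mathbb R^m$ let $H(u,a)=\{x:\langle u,x\rangle=\langle u,a\rangle\}$ and $H_-(u,a)=\{x:\langle u,x\rangle\le\langle u,a\rangle\}$. For a boundary point $a$ of a set $C$, the hyperplane $H(u,a)$ with $C\subset H_-(u,a)$ is called tangent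 to $C$ at $a$ if it is the only hyperplane supporting $C$ at $a$, i.e. $H(v,a)=H(u,a)$ for every $v\neq 0$ with $C\subset H_-(v,a)$. Let $C\subset\mathbb R^m$ be a closed convex set with nonempty interior. Then the following assertions are equivalent: (i) $C$ is $K$-invariant; (ii) $P_C$ is $K$-isotone and $K^*$-isotone; (iii) there is a countable (possibly finite or empty) index set $I\subset\mathbb N$ with $$C=\bigcap_{i\in I}H_-(u_i,a_i),$$ where $a_i$ is a boundary point of $C$ and the hyperplane $H(u_i,a_i)$ is tangent to $C$ at $a_i$ and $K$-invariant, for each $i\in I$ (the empty intersection being $\mathbb R^m$); (iv) $C$ can be represented as in (iii), where, for each $i\in I$, $a_i$ is a boundary point of $C$ and $H(u_i,a_i)$ is tangent to $C$ at $a_i$ and is both a $K$-isotone projection set and a $K^*$-isotone projection set. -/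

import Mathlib

noncomputable section

open scoped RealInnerProductSpace

namespace LatticeLike

/-- `P_D x`: the point of `D` at which the distance from `x` to `D` is attained
(see `metricProj_spec` for existence and uniqueness when `D` is nonempty, closed, convex). -/
def metricProj {m : ℕ} (D : Set (EuclideanSpace ℝ (Fin m))) (x : EuclideanSpace ℝ (Fin m)) :
    EuclideanSpace ℝ (Fin m) :=
  Classical.epsilon fun p => p ∈ D ∧ ‖x - p‖ = ⨅ y : D, ‖x - y‖

/-- For a nonempty closed convex set, `metricProj D x` is the unique nearest point of `D`. -/
theorem metricProj_spec {m : ℕ} {D : Set (EuclideanSpace ℝ (Fin m))} (hne : D.Nonempty)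
    (hcl : IsClosed D) (hcv : Convex ℝ D) (x p : EuclideanSpace ℝ (Fin m)) :
    metricProj D x = p ↔ p ∈ D ∧ ‖x - p‖ = ⨅ y : D, ‖x - y‖ := by
  have hex : ∃ p, p ∈ D ∧ ‖x - p‖ = ⨅ y : D, ‖x - y‖ := by
    obtain ⟨p, hp, h⟩ := exists_norm_eq_iInf_of_complete_convex hne hcl.isComplete hcv x
    exact ⟨p, hp, h⟩
  have hs : metricProj D x ∈ D ∧ ‖x - metricProj D x‖ = ⨅ y : D, ‖x - y‖ :=
    Classical.epsilon_spec hex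
  refine ⟨fun h => h ▸ hs, fun hp => ?_⟩
  have h1 := (norm_eq_iInf_iff_real_inner_le_zero hcv hs.1).1 hs.2 p hp.1
  have h2 := (norm_eq_iInf_iff_real_inner_le_zero hcv hp.1).1 hp.2 _ hs.1
  have h3 : ⟪p - metricProj D x, p - metricProj D x⟫ ≤ 0 := by
    have e : ⟪p - metricProj D x, p - metricProj D x⟫
        = ⟪x - metricProj D x, p - metricProj D x⟫ + ⟪x - p, metricProj D x - p⟫ := by
      simp only [inner_sub_left, inner_sub_right]
      ring
    linarith
  have h4 : p - metricProj D x = 0 := by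
    rw [real_inner_self_eq_norm_sq] at h3
    exact norm_eq_zero.1 (pow_eq_zero_iff two_ne_zero |>.1 (le_antisymm h3 (sq_nonneg _)))
  exact (sub_eq_zero.1 h4).symm

/-- The dual cone `K* = {y | ⟪x, y⟫ ≥ 0 for all x ∈ K}`. -/
def dualCone {m : ℕ} (K : ProperCone ℝ (EuclideanSpace ℝ (Fin m))) :
    ProperCone ℝ (EuclideanSpace ℝ (Fin m)) :=
  ProperCone.innerDual (K : Set (EuclideanSpace ℝ (Fin m)))

/-- The order relation `x ≤_K y`. -/
def coneLE {m : ℕ} (K : ProperCone ℝ (EuclideanSpace ℝ (Fin m)))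
    (x y : EuclideanSpace ℝ (Fin m)) : Prop :=
  y - x ∈ K

/-- The operation `x ⊓ y = P_{x - K} y`; the starred operation is `coneInf (dualCone K)`. -/
def coneInf {m : ℕ} (K : ProperCone ℝ (EuclideanSpace ℝ (Fin m)))
    (x y : EuclideanSpace ℝ (Fin m)) : EuclideanSpace ℝ (Fin m) :=
  metricProj ((fun k => x - k) '' (K : Set (EuclideanSpace ℝ (Fin m)))) y

/-- The operation `x ⊔ y = P_{x + K} y`; the starred operation is `coneSup (dualCone K)`. -/
def coneSup {m : ℕ} (K : ProperCone ℝ (EuclideanSpace ℝ (Fin m)))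
    (x y : EuclideanSpace ℝ (Fin m)) : EuclideanSpace ℝ (Fin m) :=
  metricProj ((fun k => x + k) '' (K : Set (EuclideanSpace ℝ (Fin m)))) y

/-- The set `M` is invariant with respect to the binary operation `op`. -/
def InvariantUnder {m : ℕ}
    (op : EuclideanSpace ℝ (Fin m) → EuclideanSpace ℝ (Fin m) → EuclideanSpace ℝ (Fin m))
    (M : Set (EuclideanSpace ℝ (Fin m))) : Prop :=
  ∀ x ∈ M, ∀ y ∈ M, op x y ∈ M

/-- `K`-invariance: invariance with respect to all four lattice-like operations. -/
def KInvariant {m : ℕ} (K : ProperCone ℝ (EuclideanSpace ℝ (Fin m)))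
    (M : Set (EuclideanSpace ℝ (Fin m))) : Prop :=
  InvariantUnder (coneInf K) M ∧ InvariantUnder (coneSup K) M ∧
    InvariantUnder (coneInf (dualCone K)) M ∧ InvariantUnder (coneSup (dualCone K)) M

/-- The projection `P_C` is isotone for the order given by `K`
(for a closed convex set `C`: it is a `K`-isotone projection set). -/
def IsotoneProjection {m : ℕ} (K : ProperCone ℝ (EuclideanSpace ℝ (Fin m)))
    (C : Set (EuclideanSpace ℝ (Fin m))) : Prop :=
  ∀ x y, coneLE K x y → coneLE K (metricProj C x) (metricProj C y)

/-- `H(u, a)`, a hyperplane through `a` when `u ≠ 0`. -/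
def hyperplane {m : ℕ} (u a : EuclideanSpace ℝ (Fin m)) : Set (EuclideanSpace ℝ (Fin m)) :=
  {x | ⟪u, x⟫ = ⟪u, a⟫}

/-- The closed halfspace `H₋(u, a)`. -/
def halfspace {m : ℕ} (u a : EuclideanSpace ℝ (Fin m)) : Set (EuclideanSpace ℝ (Fin m)) :=
  {x | ⟪u, x⟫ ≤ ⟪u, a⟫}

/-- `H(u, a)` supports `C` at the boundary point `a`, with `C` contained in `H₋(u, a)`. -/
def IsSupportingAt {m : ℕ} (C : Set (EuclideanSpace ℝ (Fin m)))
    (u a : EuclideanSpace ℝ (Fin m)) : Prop :=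
  u ≠ 0 ∧ a ∈ frontier C ∧ C ⊆ halfspace u a

/-- `H(u, a)` is tangent to `C` at `a`: it is the unique hyperplane supporting `C` at `a`. -/
def IsTangentAt {m : ℕ} (C : Set (EuclideanSpace ℝ (Fin m)))
    (u a : EuclideanSpace ℝ (Fin m)) : Prop :=
  IsSupportingAt C u a ∧ ∀ v, IsSupportingAt C v a → hyperplane v a = hyperplane u a

end LatticeLike

end

open scoped RealInnerProductSpace
open Set Metric

/-! Moreau's decomposition y - x = p - q with p in K, q in K* and p ⊥ q turns the four operations
into the two points x + p = y + q and x - q = y - p, so K-invariance says that C contains these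
corners along with x and y (`kInvariant_iff`). Obtuse-angle inequalities at the corners make this
equivalent to isotonicity for both cones.

For a hyperplane with normal u, isotonicity means that the orthogonal projection `perp u` preserves
the cone. If it preserves K and K*, then ⟪u, p⟫ and ⟪u, q⟫ cannot have the same strict sign, which
makes the halfspace invariant; intersections inherit invariance.

Conversely, C is cut out by its supporting halfspaces at points where a ball inside C touches the
boundary; the ball forces tangency, and the Lindelöf property leaves countably many. Near such a
point, at small scale, C looks like the halfspace, so isotonicity of `metricProj C` passes to `perp
u` in the limit, as K is closed (`IsInnerBallAt.perp_mem`). -/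

namespace LatticeLike

section

variable {m : ℕ} {K : ProperCone ℝ (EuclideanSpace ℝ (Fin m))}
  {C D : Set (EuclideanSpace ℝ (Fin m))} {a c p q u x y z : EuclideanSpace ℝ (Fin m)}

/-- The obtuse angle criterion for the metric projection. -/
theorem metricProj_eq_iff (hne : D.Nonempty) (hcl : IsClosed D) (hcv : Convex ℝ D) :
    metricProj D x = p ↔ p ∈ D ∧ ∀ w ∈ D, ⟪x - p, w - p⟫ ≤ 0 := by
  rw [metricProj_spec hne hcl hcv]
  exact and_congr_right fun hp => norm_eq_iInf_iff_real_inner_le_zero hcv hp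

theorem metricProj_mem (hne : D.Nonempty) (hcl : IsClosed D) (hcv : Convex ℝ D)
    (x : EuclideanSpace ℝ (Fin m)) : metricProj D x ∈ D :=
  ((metricProj_eq_iff hne hcl hcv).1 rfl).1

theorem inner_sub_metricProj_le (hcl : IsClosed D) (hcv : Convex ℝ D)
    (x : EuclideanSpace ℝ (Fin m)) (hy : y ∈ D) :
    ⟪x - metricProj D x, y - metricProj D x⟫ ≤ 0 :=
  ((metricProj_eq_iff ⟨y, hy⟩ hcl hcv).1 rfl).2 y hy

theorem inner_nonneg_of_mem_dualCone (hp : p ∈ K) (hq : q ∈ dualCone K) : 0 ≤ ⟪p, q⟫ :=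
  hq hp

theorem mem_dualCone_iff : y ∈ dualCone K ↔ ∀ x ∈ K, 0 ≤ ⟪x, y⟫ := Iff.rfl

@[simp]
theorem dualCone_dualCone (K : ProperCone ℝ (EuclideanSpace ℝ (Fin m))) :
    dualCone (dualCone K) = K :=
  ProperCone.innerDual_innerDual K

/-! ### Moreau decomposition and the lattice-like operations -/

/-- `(p, q)` is the Moreau decomposition of `z = p - q` with respect to `K`. -/
structure IsMoreau (K : ProperCone ℝ (EuclideanSpace ℝ (Fin m)))
    (z p q : EuclideanSpace ℝ (Fin m)) : Prop where
  left_mem : p ∈ K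
  right_mem : q ∈ dualCone K
  inner_eq : ⟪p, q⟫ = 0
  eq_sub : z = p - q

theorem IsMoreau.neg (h : IsMoreau K z p q) : IsMoreau (dualCone K) (-z) q p where
  left_mem := h.right_mem
  right_mem := by rw [dualCone_dualCone]; exact h.left_mem
  inner_eq := by rw [real_inner_comm]; exact h.inner_eq
  eq_sub := by rw [h.eq_sub]; abel

theorem IsMoreau.neg_of_dual (h : IsMoreau (dualCone K) z p q) : IsMoreau K (-z) q p := by
  simpa using h.neg

theorem exists_isMoreau (K : ProperCone ℝ (EuclideanSpace ℝ (Fin m)))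
    (z : EuclideanSpace ℝ (Fin m)) : ∃ p q, IsMoreau K z p q := by
  have hne : (K : Set (EuclideanSpace ℝ (Fin m))).Nonempty := K.nonempty
  obtain ⟨hp, hw⟩ := (metricProj_eq_iff (x := z) hne K.isClosed K.convex).1 rfl
  set p := metricProj (K : Set (EuclideanSpace ℝ (Fin m))) z
  -- Testing the obtuse angle at 0 and at 2p gives both signs of ⟪z - p, p⟫.
  have h0 := hw 0 (zero_mem K)
  have h2 := hw (p + p) (add_mem hp hp)
  simp only [zero_sub, inner_neg_right, add_sub_cancel_right] at h0 h2
  have hpz : ⟪z - p, p⟫ = 0 := by linarith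
  refine ⟨p, p - z, hp, mem_dualCone_iff.2 fun k hk => ?_, ?_, by abel⟩
  · have := hw k hk
    rw [inner_sub_right, hpz] at this
    rw [real_inner_comm, ← neg_sub z p, inner_neg_left]
    linarith
  · rw [real_inner_comm, ← neg_sub z p, inner_neg_left, hpz, neg_zero]

theorem coneSup_eq (h : IsMoreau K (y - x) p q) : coneSup K x y = x + p := by
  refine (metricProj_eq_iff (K.nonempty.image _) ?_ ?_).2 ⟨⟨p, h.left_mem, rfl⟩, ?_⟩
  · exact (Homeomorph.addLeft x).isClosedMap _ K.isClosed
  · simpa using K.convex.translate x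
  · rintro _ ⟨k, hk, rfl⟩
    have e : y - (x + p) = -q := by rw [← sub_sub, h.eq_sub]; abel
    have hk' := inner_nonneg_of_mem_dualCone hk h.right_mem
    rw [e, add_sub_add_left_eq_sub, inner_neg_left, inner_sub_right, real_inner_comm k,
      real_inner_comm p, h.inner_eq]
    linarith

theorem coneInf_eq (h : IsMoreau K (x - y) p q) : coneInf K x y = x - p := by
  refine (metricProj_eq_iff (K.nonempty.image _) ?_ ?_).2 ⟨⟨p, h.left_mem, rfl⟩, ?_⟩
  · exact (Homeomorph.subLeft x).isClosedMap _ K.isClosed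
  · have := (K.convex.neg).translate x
    rwa [← image_neg_eq_neg, image_image] at this
  · rintro _ ⟨k, hk, rfl⟩
    have e : y - (x - p) = q := by
      have := h.eq_sub
      rw [show y - (x - p) = p - (x - y) by abel, this]; abel
    have hk' := inner_nonneg_of_mem_dualCone hk h.right_mem
    rw [e, sub_sub_sub_cancel_left, inner_sub_right, real_inner_comm k,
      real_inner_comm p, h.inner_eq]
    linarith

/-- The four operations in terms of the Moreau decomposition of the difference. -/
theorem kInvariant_iff : KInvariant K C ↔
    ∀ x ∈ C, ∀ y ∈ C, ∀ p q, IsMoreau K (y - x) p q → x + p ∈ C ∧ x - q ∈ C := by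
  constructor
  · rintro ⟨h1, h2, -, -⟩ x hx y hy p q h
    have hs := h2 x hx y hy
    have hi := h1 y hy x hx
    rw [coneSup_eq h] at hs
    rw [coneInf_eq h] at hi
    refine ⟨hs, ?_⟩
    rwa [show x - q = y - p by rw [sub_eq_iff_eq_add.1 h.eq_sub]; abel]
  · intro H
    refine ⟨?_, ?_, ?_, ?_⟩ <;> intro x hx y hy
    · obtain ⟨p, q, h⟩ := exists_isMoreau K (x - y)
      rw [coneInf_eq h, show x - p = y - q by rw [sub_eq_iff_eq_add.1 h.eq_sub]; abel]
      exact (H y hy x hx p q h).2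
    · obtain ⟨p, q, h⟩ := exists_isMoreau K (y - x)
      rw [coneSup_eq h]
      exact (H x hx y hy p q h).1
    · obtain ⟨p, q, h⟩ := exists_isMoreau (dualCone K) (x - y)
      rw [coneInf_eq h]
      have h' := h.neg_of_dual
      rw [neg_sub] at h'
      exact (H x hx y hy q p h').2
    · obtain ⟨p, q, h⟩ := exists_isMoreau (dualCone K) (y - x)
      rw [coneSup_eq h]
      have h' := h.neg_of_dual
      rw [neg_sub] at h'
      rw [show x + p = y + q by rw [sub_eq_iff_eq_add.1 h.eq_sub]; abel]
      exact (H y hy x hx q p h').1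

/-! ### Invariance and isotonicity -/

theorem KInvariant.dual (h : KInvariant K C) : KInvariant (dualCone K) C := by
  obtain ⟨h1, h2, h3, h4⟩ := h
  exact ⟨h3, h4, by simpa using h1, by simpa using h2⟩

/-- Decompose the difference of the projections x', y' as p - q. The obtuse angles at y' towards x'
+ p and at x' towards x' - q add up to ⟪y - x, q⟫ + ‖q‖² ≤ 0, whose first term is nonnegative, so q
= 0. -/
theorem KInvariant.isotoneProjection (hne : C.Nonempty) (hcl : IsClosed C) (hcv : Convex ℝ C)
    (h : KInvariant K C) : IsotoneProjection K C := by
  intro x y hxy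
  rw [coneLE] at hxy ⊢
  have hu := metricProj_mem hne hcl hcv x
  have hv := metricProj_mem hne hcl hcv y
  obtain ⟨p, q, hM⟩ := exists_isMoreau K (metricProj C y - metricProj C x)
  obtain ⟨h1, h2⟩ := kInvariant_iff.1 h _ hu _ hv _ _ hM
  have e1 := inner_sub_metricProj_le hcl hcv y h1
  have e2 := inner_sub_metricProj_le hcl hcv x h2
  have hz := hM.eq_sub
  generalize metricProj C x = x' at *
  generalize metricProj C y = y' at *
  obtain rfl : y' = x' + p - q := by rw [add_sub_assoc, ← hz]; abel
  have e3 := inner_nonneg_of_mem_dualCone hxy hM.right_mem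
  have e4 := hM.inner_eq
  have hq : ⟪q, q⟫ ≤ 0 := by
    rw [show x' + p - (x' + p - q) = q by abel] at e1
    rw [show x' - q - x' = -q by abel] at e2
    simp only [inner_sub_left, inner_add_left, inner_neg_right] at *
    linarith
  have hq0 : q = 0 := real_inner_self_nonpos.1 hq
  rw [hz, hq0, sub_zero]
  exact hM.left_mem

/-- The corner x + p is K-above x and K*-above y. If projecting it moves it by d, isotonicity gives
p + d ∈ K and q + d ∈ K*, while the obtuse angles towards x and y bound ⟪d, p⟫ and ⟪d, q⟫ by -‖d‖²;
these force d = 0. The corner x - q is treated symmetrically, with displacement -d. -/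
theorem kInvariant_of_isotoneProjection (hcl : IsClosed C) (hcv : Convex ℝ C)
    (h1 : IsotoneProjection K C) (h2 : IsotoneProjection (dualCone K) C) : KInvariant K C := by
  have fixed : ∀ x ∈ C, metricProj C x = x := fun x hx =>
    (metricProj_eq_iff ⟨x, hx⟩ hcl hcv).2 ⟨hx, by simp⟩
  refine kInvariant_iff.2 fun x hx y hy p q h => ?_
  have hy' : y = x + p - q := by rw [add_sub_assoc, ← h.eq_sub]; abel
  have hpq := h.inner_eq
  have zero_of : ∀ d : EuclideanSpace ℝ (Fin m), 0 ≤ ⟪p + d, q + d⟫ → ⟪-d, -p - d⟫ ≤ 0 →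
      ⟪-d, -q - d⟫ ≤ 0 → d = 0 := by
    intro d e1 e2 e3
    refine (real_inner_self_nonpos (x := d)).1 ?_
    have c1 := real_inner_comm d p
    have c2 := real_inner_comm d q
    simp only [inner_sub_right, inner_add_left, inner_add_right, inner_neg_left,
      inner_neg_right] at *
    linarith
  constructor
  · have m1 := h1 x (x + p) (by simpa [coneLE] using h.left_mem)
    have m2 := h2 y (x + p) (by
      rw [coneLE, hy', sub_sub_cancel]; exact h.right_mem)
    rw [coneLE, fixed x hx] at m1
    rw [coneLE, fixed y hy] at m2
    have o1 := inner_sub_metricProj_le hcl hcv (x + p) hx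
    have o2 := inner_sub_metricProj_le hcl hcv (x + p) hy
    have hmem := metricProj_mem ⟨x, hx⟩ hcl hcv (x + p)
    obtain ⟨d, hd⟩ : ∃ d, metricProj C (x + p) = x + p + d := ⟨_, (add_sub_cancel _ _).symm⟩
    rw [hd] at m1 m2 o1 o2 hmem
    have := zero_of d ?_ ?_ ?_
    · simpa [this] using hmem
    · refine inner_nonneg_of_mem_dualCone (K := K) ?_ ?_
      · convert m1 using 1; abel
      · convert m2 using 1; rw [hy']; abel
    · convert o1 using 2 <;> abel
    · convert o2 using 2
      · abel
      · rw [hy']; abel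
  · have m1 := h1 (x - q) y (by
      rw [coneLE, hy', show x + p - q - (x - q) = p by abel]; exact h.left_mem)
    have m2 := h2 (x - q) x (by rw [coneLE, sub_sub_cancel]; exact h.right_mem)
    rw [coneLE, fixed y hy] at m1
    rw [coneLE, fixed x hx] at m2
    have o1 := inner_sub_metricProj_le hcl hcv (x - q) hy
    have o2 := inner_sub_metricProj_le hcl hcv (x - q) hx
    have hmem := metricProj_mem ⟨x, hx⟩ hcl hcv (x - q)
    obtain ⟨d, hd⟩ : ∃ d, metricProj C (x - q) = x - q - d := ⟨_, (sub_sub_cancel _ _).symm⟩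
    rw [hd] at m1 m2 o1 o2 hmem
    have := zero_of d ?_ ?_ ?_
    · simpa [this] using hmem
    · refine inner_nonneg_of_mem_dualCone (K := K) ?_ ?_
      · convert m1 using 1; rw [hy']; abel
      · convert m2 using 1; abel
    · rw [← inner_neg_neg]
      convert o1 using 2
      · abel
      · rw [hy']; abel
    · rw [← inner_neg_neg]
      convert o2 using 2 <;> abel

theorem kInvariant_iff_isotoneProjection (hne : C.Nonempty) (hcl : IsClosed C)
    (hcv : Convex ℝ C) :
    KInvariant K C ↔ IsotoneProjection K C ∧ IsotoneProjection (dualCone K) C :=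
  ⟨fun h => ⟨h.isotoneProjection hne hcl hcv, h.dual.isotoneProjection hne hcl hcv⟩,
    fun h => kInvariant_of_isotoneProjection hcl hcv h.1 h.2⟩

/-! ### Hyperplanes and halfspaces -/

theorem self_mem_hyperplane (u a : EuclideanSpace ℝ (Fin m)) : a ∈ hyperplane u a :=
  rfl

theorem isClosed_hyperplane (u a : EuclideanSpace ℝ (Fin m)) : IsClosed (hyperplane u a) :=
  isClosed_eq (by fun_prop) (by fun_prop)

theorem convex_hyperplane (u a : EuclideanSpace ℝ (Fin m)) : Convex ℝ (hyperplane u a) :=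
  _root_.convex_hyperplane (innerₗ _ u).isLinear ⟪u, a⟫

theorem isClosed_halfspace (u a : EuclideanSpace ℝ (Fin m)) : IsClosed (halfspace u a) :=
  isClosed_le (by fun_prop) (by fun_prop)

/-- The orthogonal projection onto the subspace orthogonal to `u`. -/
noncomputable def perp (u k : EuclideanSpace ℝ (Fin m)) : EuclideanSpace ℝ (Fin m) :=
  k - (⟪u, k⟫ / ⟪u, u⟫) • u

theorem inner_perp (hu : u ≠ 0) (k : EuclideanSpace ℝ (Fin m)) : ⟪u, perp u k⟫ = 0 := by
  have : ⟪u, u⟫ ≠ 0 := inner_self_ne_zero.2 hu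
  rw [perp, inner_sub_right, inner_smul_right, div_mul_cancel₀ _ this, sub_self]

theorem metricProj_hyperplane (hu : u ≠ 0) (x : EuclideanSpace ℝ (Fin m)) :
    metricProj (hyperplane u a) x = a + perp u (x - a) := by
  refine (metricProj_eq_iff ⟨a, self_mem_hyperplane u a⟩ (isClosed_hyperplane u a)
    (convex_hyperplane u a)).2 ⟨?_, ?_⟩
  · simp [hyperplane, inner_add_right, inner_perp hu]
  · intro w hw
    have e : x - (a + perp u (x - a)) = (⟪u, x - a⟫ / ⟪u, u⟫) • u := by rw [perp]; abel
    rw [hyperplane, mem_ofPred_eq] at hw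
    rw [e, inner_smul_left, inner_sub_right u w, inner_add_right, inner_perp hu, hw]
    simp

theorem isotoneProjection_hyperplane_iff (hu : u ≠ 0) :
    IsotoneProjection K (hyperplane u a) ↔ ∀ k ∈ K, perp u k ∈ K := by
  have key : ∀ x y, metricProj (hyperplane u a) y - metricProj (hyperplane u a) x
      = perp u (y - x) := by
    intro x y
    rw [metricProj_hyperplane hu, metricProj_hyperplane hu]
    simp only [perp, inner_sub_right, sub_div, sub_smul]
    abel
  simp only [IsotoneProjection, coneLE, key]
  exact ⟨fun h k hk => by simpa using h 0 k (by simpa using hk), fun h x y => h _⟩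

theorem kInvariant_halfspace (hu : u ≠ 0) (h : KInvariant K (hyperplane u a)) :
    KInvariant K (halfspace u a) := by
  obtain ⟨h1, h2⟩ := (kInvariant_iff_isotoneProjection ⟨a, self_mem_hyperplane u a⟩
    (isClosed_hyperplane u a) (convex_hyperplane u a)).1 h
  rw [isotoneProjection_hyperplane_iff hu] at h1 h2
  refine kInvariant_iff.2 fun x hx y hy p q h => ?_
  have hy' : y = x + p - q := by rw [add_sub_assoc, ← h.eq_sub]; abel
  have hpos : 0 < ⟪u, u⟫ := real_inner_self_pos.2 hu
  -- Since p ⊥ q, the nonnegative product of the projected vectors is -⟪u, p⟫⟪u, q⟫ / ⟪u, u⟫. A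
  -- corner leaving the halfspace while x and y stay in it would give both factors the same strict
  -- sign.
  have hpq : ⟪u, p⟫ * ⟪u, q⟫ ≤ 0 := by
    have := inner_nonneg_of_mem_dualCone (h1 p h.left_mem) (h2 q h.right_mem)
    have e : ⟪perp u p, perp u q⟫ = -(⟪u, p⟫ * ⟪u, q⟫ / ⟪u, u⟫) := by
      rw [perp, inner_sub_left, inner_smul_left, inner_perp hu, perp, inner_sub_right,
        inner_smul_right, h.inner_eq, real_inner_comm u p]
      simp
      ring
    rw [e, neg_nonneg] at this
    by_contra! hlt
    exact absurd this (not_le.2 (div_pos hlt hpos))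
  subst hy'
  simp only [halfspace, mem_ofPred_eq, inner_sub_right, inner_add_right] at *
  constructor
  · by_contra! hlt
    exact absurd hpq (not_le.2 (mul_pos (by linarith) (by linarith)))
  · by_contra! hlt
    exact absurd hpq (not_le.2 (mul_pos_of_neg_of_neg (by linarith) (by linarith)))

theorem kInvariant_biInter {ι : Type*} {I : Set ι} {M : ι → Set (EuclideanSpace ℝ (Fin m))}
    (h : ∀ i ∈ I, KInvariant K (M i)) : KInvariant K (⋂ i ∈ I, M i) := by
  refine ⟨?_, ?_, ?_, ?_⟩ <;> intro x hx y hy <;> rw [mem_iInter₂] at * <;> intro i hi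
  · exact (h i hi).1 x (hx i hi) y (hy i hi)
  · exact (h i hi).2.1 x (hx i hi) y (hy i hi)
  · exact (h i hi).2.2.1 x (hx i hi) y (hy i hi)
  · exact (h i hi).2.2.2 x (hx i hi) y (hy i hi)

/-! ### Inner balls and tangency -/

/-- A ball inside `C` touches the boundary of `C` at `a`; `u` is the vector from the centre to
`a`. -/
structure IsInnerBallAt (C : Set (EuclideanSpace ℝ (Fin m)))
    (u a : EuclideanSpace ℝ (Fin m)) : Prop where
  ne_zero : u ≠ 0
  mem_frontier : a ∈ frontier C
  closedBall_subset : closedBall (a - u) ‖u‖ ⊆ C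

theorem exists_isSupportingAt (hcv : Convex ℝ C) (hint : (interior C).Nonempty)
    (ha : a ∈ frontier C) : ∃ v, IsSupportingAt C v a := by
  obtain ⟨f, hf⟩ := geometric_hahn_banach_open_point hcv.interior isOpen_interior ha.2
  obtain ⟨v, rfl⟩ := (InnerProductSpace.toDual ℝ (EuclideanSpace ℝ (Fin m))).surjective f
  simp only [InnerProductSpace.toDual_apply_apply] at hf
  refine ⟨v, ?_, ha, ?_⟩
  · rintro rfl
    obtain ⟨w, hw⟩ := hint
    simpa using hf w hw
  · have : closure (interior C) ⊆ halfspace v a :=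
      closure_minimal (fun w hw => (hf w hw).le) (isClosed_halfspace v a)
    rw [hcv.closure_interior_eq_closure_of_nonempty_interior hint] at this
    exact subset_closure.trans this

/-- The point of the ball farthest in direction v still lies in the halfspace, which is the equality
case of Cauchy–Schwarz for v and u. -/
theorem IsInnerBallAt.eq_smul (h : IsInnerBallAt C u a) {v : EuclideanSpace ℝ (Fin m)}
    (hv : IsSupportingAt C v a) : ∃ r : ℝ, 0 < r ∧ v = r • u := by
  have hu : 0 < ‖u‖ := norm_pos_iff.2 h.ne_zero
  have hv0 : 0 < ‖v‖ := norm_pos_iff.2 hv.1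
  have hmem : a - u + (‖u‖ / ‖v‖) • v ∈ C := by
    apply h.closedBall_subset
    rw [mem_closedBall, dist_eq_norm, add_sub_cancel_left, norm_smul, norm_div, norm_norm,
      norm_norm, div_mul_cancel₀ _ hv0.ne']
  have h1 : ⟪v, a - u + (‖u‖ / ‖v‖) • v⟫ ≤ ⟪v, a⟫ := hv.2.2 hmem
  have h2 : ‖v‖ * ‖u‖ ≤ ⟪v, u⟫ := by
    rw [inner_add_right, inner_sub_right, inner_smul_right, real_inner_self_eq_norm_sq] at h1
    have : ‖u‖ / ‖v‖ * ‖v‖ ^ 2 = ‖v‖ * ‖u‖ := by field_simp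
    linarith
  have h3 := inner_eq_norm_mul_iff_real.1 (le_antisymm (real_inner_le_norm v u) h2)
  refine ⟨‖v‖ / ‖u‖, div_pos hv0 hu, ?_⟩
  rw [div_eq_inv_mul, mul_smul, ← h3, inv_smul_smul₀ hu.ne']

theorem IsInnerBallAt.isTangentAt (h : IsInnerBallAt C u a) (hcv : Convex ℝ C)
    (hint : (interior C).Nonempty) : IsTangentAt C u a := by
  refine ⟨⟨h.ne_zero, h.mem_frontier, ?_⟩, ?_⟩
  · obtain ⟨v, hv⟩ := exists_isSupportingAt hcv hint h.mem_frontier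
    obtain ⟨r, hr, rfl⟩ := h.eq_smul hv
    intro w hw
    have := hv.2.2 hw
    simp only [halfspace, mem_ofPred_eq, real_inner_smul_left] at this ⊢
    exact le_of_mul_le_mul_left this hr
  · intro v hv
    obtain ⟨r, hr, rfl⟩ := h.eq_smul hv
    ext w
    simp [hyperplane, real_inner_smul_left, hr.ne']

/-- Isotonicity of the projection passes to the hyperplane supporting an inner ball. -/
theorem IsInnerBallAt.perp_mem (h : IsInnerBallAt C u a) (hcl : IsClosed C) (hcv : Convex ℝ C)
    (hsub : C ⊆ halfspace u a) (hiso : IsotoneProjection K C) {k : EuclideanSpace ℝ (Fin m)}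
    (hk : k ∈ K) : perp u k ∈ K := by
  have haC : a ∈ C := hcl.frontier_subset h.mem_frontier
  have hpos : 0 < ⟪u, u⟫ := real_inner_self_pos.2 h.ne_zero
  -- N ≥ 0 keeps the first test point on the outward normal ray at a, so it projects to a. The
  -- second has normal height s = N + b, so that the two differ by t • k; s ≥ 1 ensures s ≥ ε below.
  set b := ⟪u, k⟫ / ⟪u, u⟫ with hb
  set N := |b| + 1 with hN
  set s := N + b with hs
  have hN0 : 0 ≤ N := by positivity
  have hs1 : 1 ≤ s := by linarith [neg_abs_le b]
  have hQ : k = perp u k + b • u := by rw [perp]; abel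
  have hperp := inner_perp h.ne_zero k
  have approx : ∀ ε : ℝ, 0 < ε → ε ≤ 1 →
      ∃ d ∈ K, ‖perp u k - d‖ ^ 2 ≤ s * ε * ⟪u, u⟫ := by
    intro ε hε hε1
    set w := perp u k - ε • u with hw
    -- This is the bound that puts a + t • w in the inner ball; the + 1 in the witness covers w = 0.
    obtain ⟨t, ht, htw⟩ : ∃ t : ℝ, 0 < t ∧ t * ‖w‖ ^ 2 ≤ 2 * ε * ⟪u, u⟫ := by
      refine ⟨2 * ε * ⟪u, u⟫ / (‖w‖ ^ 2 + 1), by positivity, ?_⟩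
      rw [div_mul_eq_mul_div, div_le_iff₀ (by positivity)]
      have : 0 ≤ 2 * ε * ⟪u, u⟫ := by positivity
      nlinarith
    have hball : a + t • w ∈ C := by
      apply h.closedBall_subset
      rw [mem_closedBall, dist_eq_norm, show a + t • w - (a - u) = u + t • w by abel]
      refine (sq_le_sq₀ (norm_nonneg _) (norm_nonneg u)).1 ?_
      have : ⟪u, w⟫ = -(ε * ⟪u, u⟫) := by
        rw [hw, inner_sub_right, hperp, inner_smul_right]; ring
      rw [norm_add_sq_real, inner_smul_right, this, norm_smul, mul_pow, Real.norm_eq_abs, sq_abs]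
      nlinarith
    have hx : metricProj C (a + (t * N) • u) = a := by
      refine (metricProj_eq_iff ⟨a, haC⟩ hcl hcv).2 ⟨haC, fun v hv => ?_⟩
      have hv' : ⟪u, v⟫ ≤ ⟪u, a⟫ := hsub hv
      rw [add_sub_cancel_left, real_inner_smul_left, inner_sub_right]
      exact mul_nonpos_of_nonneg_of_nonpos (by positivity) (by linarith)
    have hm := hiso (a + (t * N) • u) (a + t • (perp u k + s • u)) (by
      rw [coneLE, show a + t • (perp u k + s • u) - (a + (t * N) • u) = t • k by
        conv_rhs => rw [hQ]
        rw [hs]; module]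
      exact K.smul_mem hk ht.le)
    rw [coneLE, hx] at hm
    have ho := inner_sub_metricProj_le hcl hcv (a + t • (perp u k + s • u)) hball
    have hmem : ⟪u, _⟫ ≤ ⟪u, a⟫ :=
      hsub (metricProj_mem ⟨a, haC⟩ hcl hcv (a + t • (perp u k + s • u)))
    obtain ⟨d, hd⟩ : ∃ d, metricProj C (a + t • (perp u k + s • u)) = a + t • d :=
      ⟨t⁻¹ • (metricProj C (a + t • (perp u k + s • u)) - a), by
        rw [smul_inv_smul₀ ht.ne']; abel⟩
    rw [hd] at hm ho hmem
    rw [add_sub_cancel_left] at hm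
    have hdK : d ∈ K := by simpa [ht.ne'] using K.smul_mem hm (inv_nonneg.2 ht.le)
    refine ⟨d, hdK, ?_⟩
    have hud : ⟪u, d⟫ ≤ 0 := by
      rw [inner_add_right, inner_smul_right] at hmem
      by_contra! hlt
      linarith [mul_pos ht hlt]
    obtain ⟨e, he⟩ : ∃ e, e = perp u k - d := ⟨_, rfl⟩
    rw [← he]
    have hue : 0 ≤ ⟪u, e⟫ := by rw [he, inner_sub_right, hperp]; linarith
    rw [show a + t • (perp u k + s • u) - (a + t • d) = t • (e + s • u) by rw [he]; module,
      show a + t • w - (a + t • d) = t • (e - ε • u) by rw [he, hw]; module,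
      real_inner_smul_left, real_inner_smul_right] at ho
    -- Expanded, this reads ‖e‖² + (s - ε)⟪u, e⟫ ≤ sε⟪u, u⟫, with nonnegative middle term.
    have ho' : ⟪e + s • u, e - ε • u⟫ ≤ 0 := by
      by_contra! hlt
      linarith [mul_pos ht (mul_pos ht hlt)]
    rw [inner_add_left, inner_sub_right, inner_sub_right, real_inner_smul_left,
      real_inner_smul_left, inner_smul_right, inner_smul_right, real_inner_comm u e,
      real_inner_self_eq_norm_sq e] at ho'
    have : 0 ≤ (s - ε) * ⟪u, e⟫ := mul_nonneg (by linarith) hue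
    linarith
  have hcl' : perp u k ∈ closure (K : Set (EuclideanSpace ℝ (Fin m))) := by
    refine Metric.mem_closure_iff.2 fun δ hδ => ?_
    have hsu : 0 < s * ⟪u, u⟫ := by positivity
    obtain ⟨ε, hε, hε'⟩ : ∃ ε : ℝ, 0 < ε ∧ ε < min 1 (δ ^ 2 / (s * ⟪u, u⟫)) :=
      exists_between (lt_min one_pos (by positivity))
    obtain ⟨d, hd, hle⟩ := approx ε hε (hε'.le.trans (min_le_left _ _))
    refine ⟨d, hd, ?_⟩
    rw [dist_eq_norm]
    refine lt_of_pow_lt_pow_left₀ 2 hδ.le (hle.trans_lt ?_)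
    have := (lt_div_iff₀ hsu).1 (hε'.trans_le (min_le_right _ _))
    linarith
  rwa [K.isClosed.closure_eq] at hcl'

/-! ### Countable representation by tangent halfspaces -/

/-- A point outside `C` is cut off by a hyperplane supporting an inner ball of `C`. -/
theorem exists_isInnerBallAt_of_notMem (hcl : IsClosed C) (hint : (interior C).Nonempty)
    (hcv : Convex ℝ C) (hx : x ∉ C) : ∃ u a, IsInnerBallAt C u a ∧ x ∉ halfspace u a := by
  obtain ⟨c₀, hc₀⟩ := hint
  obtain ⟨ρ, hρ, hball⟩ := nhds_basis_closedBall.mem_iff.1 (mem_interior_iff_mem_nhds.1 hc₀)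
  have hc₀C : c₀ ∈ C := interior_subset hc₀
  have hxc : 0 < ‖x - c₀‖ := norm_pos_iff.2 (sub_ne_zero.2 (by rintro rfl; exact hx hc₀C))
  have hF : IsClosed (interior C)ᶜ := isOpen_interior.isClosed_compl
  have hxF : x ∈ (interior C)ᶜ := fun h => hx (interior_subset h)
  have hη : 0 < infDist x C := (hcl.notMem_iff_infDist_pos ⟨c₀, hc₀C⟩).1 hx
  have hρ' : 0 < infDist c₀ (interior C)ᶜ :=
    (hF.notMem_iff_infDist_pos ⟨x, hxF⟩).1 (not_not.2 hc₀)
  -- The first bound lets the distance to the complement of the interior take the value δ on the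
  -- segment from c₀ to x. The second makes δ < (1 - t)ρ, whereas x in the halfspace would give δ ≥
  -- (1 - t)ρ, by the ball of radius ρ at c₀.
  obtain ⟨δ, hδ, hδ'⟩ : ∃ δ : ℝ, 0 < δ ∧
      δ < min (infDist c₀ (interior C)ᶜ) (infDist x C * ρ / ‖x - c₀‖) :=
    exists_between (lt_min hρ' (by positivity))
  have hcont : ContinuousOn
      (fun t : ℝ => infDist (c₀ + t • (x - c₀)) (interior C)ᶜ) (Icc 0 1) := by
    have := continuous_infDist_pt (interior C)ᶜ
    fun_prop
  obtain ⟨t, ⟨ht0, ht1⟩, ht⟩ : δ ∈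
      (fun t : ℝ => infDist (c₀ + t • (x - c₀)) (interior C)ᶜ) '' Icc 0 1 := by
    refine intermediate_value_Icc' zero_le_one hcont ⟨?_, ?_⟩
    · simpa [infDist_zero_of_mem hxF] using hδ.le
    · simpa using (hδ'.trans_le (min_le_left _ _)).le
  set c := c₀ + t • (x - c₀) with hc
  simp only [] at ht
  obtain ⟨a, haF, hac⟩ := hF.exists_infDist_eq_dist ⟨x, hxF⟩ c
  rw [ht, dist_comm, dist_eq_norm] at hac
  have hu : a - c ≠ 0 := norm_pos_iff.1 (hac ▸ hδ)
  have hsub : closedBall c δ ⊆ C := by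
    rw [← closure_ball c hδ.ne']
    refine closure_minimal (fun w hw => ?_) hcl
    by_contra hwC
    have : infDist c (interior C)ᶜ ≤ dist c w :=
      infDist_le_dist_of_mem fun hwi => hwC (interior_subset hwi)
    rw [ht, dist_comm] at this
    exact absurd (mem_ball.1 hw) (not_lt.2 this)
  have haC : a ∈ C := hsub (by rw [mem_closedBall, dist_eq_norm, ← hac])
  have hI : IsInnerBallAt C (a - c) a :=
    ⟨hu, ⟨subset_closure haC, haF⟩, by rw [sub_sub_cancel, ← hac]; exact hsub⟩
  refine ⟨a - c, a, hI, fun hxH => ?_⟩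
  have hsup := (hI.isTangentAt hcv ⟨c₀, hc₀⟩).1.2.2
  have h1 : ⟪a - c, c₀ + (ρ / δ) • (a - c)⟫ ≤ ⟪a - c, a⟫ := by
    refine hsup (hball ?_)
    rw [mem_closedBall, dist_eq_norm, add_sub_cancel_left, norm_smul, ← hac, norm_div,
      Real.norm_of_nonneg hρ.le, Real.norm_of_nonneg hδ.le, div_mul_cancel₀ _ hδ.ne']
  have h2 : ⟪a - c, x⟫ ≤ ⟪a - c, a⟫ := hxH
  have h3 : ⟪a - c, a⟫ = ⟪a - c, c⟫ + δ ^ 2 := by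
    rw [hac, ← real_inner_self_eq_norm_sq, ← inner_add_right]; congr 1; abel
  have h4 : ⟪a - c, c⟫ = (1 - t) * ⟪a - c, c₀⟫ + t * ⟪a - c, x⟫ := by
    rw [← inner_smul_right, ← inner_smul_right, ← inner_add_right]
    congr 1
    rw [hc]
    module
  have h5 : infDist x C ≤ (1 - t) * ‖x - c₀‖ := by
    refine (infDist_le_dist_of_mem (hsub (mem_closedBall_self hδ.le))).trans_eq ?_
    rw [dist_eq_norm, show x - c = (1 - t) • (x - c₀) by rw [hc]; module, norm_smul,
      Real.norm_of_nonneg (by linarith)]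
  have h6 : δ < (1 - t) * ρ := by
    refine (hδ'.trans_le (min_le_right _ _)).trans_le ?_
    rw [div_le_iff₀ hxc]
    nlinarith
  rw [inner_add_right, inner_smul_right, real_inner_self_eq_norm_sq, ← hac,
    show ρ / δ * δ ^ 2 = ρ * δ by field_simp] at h1
  have h7 := mul_le_mul_of_nonneg_left h1 (sub_nonneg.2 ht1)
  have h8 := mul_le_mul_of_nonneg_left h2 ht0
  have h9 := mul_lt_mul_of_pos_right h6 hδ
  nlinarith

/-- `C` is the intersection of countably many halfspaces supporting inner balls. -/
theorem exists_eq_biInter_halfspace (hcl : IsClosed C) (hcv : Convex ℝ C)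
    (hint : (interior C).Nonempty) :
    ∃ (I : Set ℕ) (u a : ℕ → EuclideanSpace ℝ (Fin m)),
      C = ⋂ i ∈ I, halfspace (u i) (a i) ∧ ∀ i ∈ I, IsInnerBallAt C (u i) (a i) := by
  -- Lindelöf: countably many of the open complementary halfspaces already have the same union.
  obtain ⟨T, hTS, hT, hU⟩ := TopologicalSpace.isOpen_biUnion_countable
    {w : EuclideanSpace ℝ (Fin m) × EuclideanSpace ℝ (Fin m) | IsInnerBallAt C w.1 w.2}
    (fun w => (halfspace w.1 w.2)ᶜ) fun w _ => (isClosed_halfspace w.1 w.2).isOpen_compl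
  have hC : C = ⋂ w ∈ T, halfspace w.1 w.2 := by
    refine Subset.antisymm ?_ fun x hx => ?_
    · exact subset_iInter₂ fun w hw => ((hTS hw).isTangentAt hcv hint).1.2.2
    · by_contra hxC
      obtain ⟨u, a, hua, hxu⟩ := exists_isInnerBallAt_of_notMem hcl hint hcv hxC
      have : x ∈ ⋃ w ∈ T, (halfspace w.1 w.2)ᶜ := by
        rw [hU]
        exact mem_biUnion (x := (u, a)) hua hxu
      obtain ⟨w, hw, hxw⟩ := mem_iUnion₂.1 this
      exact hxw (mem_iInter₂.1 hx w hw)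
  rcases T.eq_empty_or_nonempty with rfl | hne
  · exact ⟨∅, 0, 0, by simpa using hC, by simp⟩
  · obtain ⟨f, rfl⟩ := hT.exists_eq_range hne
    refine ⟨univ, fun i => (f i).1, fun i => (f i).2, ?_, fun i _ => hTS ⟨i, rfl⟩⟩
    simpa using hC

end

end LatticeLike

theorem corollary1 (m : ℕ) (K : ProperCone ℝ (EuclideanSpace ℝ (Fin m)))
    (C : Set (EuclideanSpace ℝ (Fin m))) (hclosed : IsClosed C) (hconvex : Convex ℝ C)
    (hint : (interior C).Nonempty) :
    List.TFAE [
      LatticeLike.KInvariant K C,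
      LatticeLike.IsotoneProjection K C ∧
        LatticeLike.IsotoneProjection (LatticeLike.dualCone K) C,
      ∃ (I : Set ℕ) (u a : ℕ → EuclideanSpace ℝ (Fin m)),
        C = ⋂ i ∈ I, LatticeLike.halfspace (u i) (a i) ∧
        ∀ i ∈ I, LatticeLike.IsTangentAt C (u i) (a i) ∧
          LatticeLike.KInvariant K (LatticeLike.hyperplane (u i) (a i)),
      ∃ (I : Set ℕ) (u a : ℕ → EuclideanSpace ℝ (Fin m)),
        C = ⋂ i ∈ I, LatticeLike.halfspace (u i) (a i) ∧
        ∀ i ∈ I, LatticeLike.IsTangentAt C (u i) (a i) ∧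
          LatticeLike.IsotoneProjection K (LatticeLike.hyperplane (u i) (a i)) ∧
          LatticeLike.IsotoneProjection (LatticeLike.dualCone K)
            (LatticeLike.hyperplane (u i) (a i))] := by
  have hne : C.Nonempty := hint.mono interior_subset
  have hhyp (u a : EuclideanSpace ℝ (Fin m)) :
      LatticeLike.KInvariant K (LatticeLike.hyperplane u a) ↔
        LatticeLike.IsotoneProjection K (LatticeLike.hyperplane u a) ∧
          LatticeLike.IsotoneProjection (LatticeLike.dualCone K) (LatticeLike.hyperplane u a) :=
    LatticeLike.kInvariant_iff_isotoneProjection ⟨a, LatticeLike.self_mem_hyperplane u a⟩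
      (LatticeLike.isClosed_hyperplane u a)
      (LatticeLike.convex_hyperplane u a)
  tfae_have 1 ↔ 2 := LatticeLike.kInvariant_iff_isotoneProjection hne hclosed hconvex
  tfae_have 3 ↔ 4 := by simp only [hhyp]
  tfae_have 3 → 1 := by
    rintro ⟨I, u, a, hC, h⟩
    rw [hC]
    exact LatticeLike.kInvariant_biInter fun i hi =>
      LatticeLike.kInvariant_halfspace (h i hi).1.1.1 (h i hi).2
  tfae_have 2 → 4 := by
    rintro ⟨h1, h2⟩
    obtain ⟨I, u, a, hC, h⟩ := LatticeLike.exists_eq_biInter_halfspace hclosed hconvex hint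
    refine ⟨I, u, a, hC, fun i hi => ?_⟩
    have htan := (h i hi).isTangentAt hconvex hint
    refine ⟨htan, ?_, ?_⟩
    · exact (LatticeLike.isotoneProjection_hyperplane_iff (h i hi).ne_zero).2 fun k hk =>
        (h i hi).perp_mem hclosed hconvex htan.1.2.2 h1 hk
    · exact (LatticeLike.isotoneProjection_hyperplane_iff (h i hi).ne_zero).2 fun k hk =>
        (h i hi).perp_mem hclosed hconvex htan.1.2.2 h2 hk
  tfae_finish
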